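/- **Model.** There are $n=3$ items and $k=2$ slots. Item $i$ can be displayed as an ad or as an organic item, with click-through rates $0\le\alpha_i^A<\alpha_i^O\le 1$ and user-experience effects $0\le\gamma_i^A\le\gamma_i^O$. The bid $b_i$ of owner $i$ is drawn, independently over $i$, from a distribution $F_i$ with support $[0,B_i]$ and a density $f_i$ that is positive on $[0,B_i)$, and $F_i$ is regular: the virtual value $\phi_i(t)=t-\frac{1-F_i(t)}{f_i(t)}$ is non-decreasing on $[0,B_i]$. A merging mechanism consists of (measurable) rules $x_i(b),y_i(b)\in\{0,1\}$ (item $i$ is displayed as an ad, respectively as an organic item) and payments per click $p_i(b)\in\mathbb R$ with $p_i(b)=0$ if $x_i(b)=0$, such that expected revenue is well defined. With $X_i=\alpha_i^Ax_i+\alpha_i^Oy_i$ and $P_i=\alpha_i^Ap_ix_i$, it is * feasible if $\sum_i(x_i+y_i)\le k$ and $x_i+y_i\le1$ for every $i$; * incentive compatible (IC) if $b_iX_i(b)-P_i(b)\ge b_iX_i(b_i',b_{-i})-P_i(b_i',b_{-i})$ for all profiles $b\in\prod_j[0,B_j]$, all $i$ and all $b_i'\in[0,B_i]$; * individually rational (IR)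 if $p_i(b)\le b_i$ for all $b$ and $i$. Its objective is $\mathrm{OBJ}(\mathcal M)=\mathbb E_b\big[\sum_iP_i(b)\big]+\mathbb E_b\big[\sum_i(\gamma_i^Ax_i(b)+\gamma_i^Oy_i(b))\big]$. A mechanism is $\tau$-approximate if it is feasible, IC and IR and its objective is at least $\tau$ times the objective of every feasible, IC and IR mechanism (hence at least $\tau$ times the optimum). **Generalized fix mechanism.** Put $a_i=\alpha_i^A\phi_i(b_i)+\gamma_i^A$ and $o_i=\gamma_i^O$. For a set $I$ of items, the mechanism $\mathcal M_I^F$ admits the items of $I$ in organic form only, with contribution $o_i$, and the other items as ads only, with contribution $a_i$. It displays the $k$ items of highest contribution (ties are broken by index); a displayed ad pays its critical bid $\inf\{t\in[0,B_i]: x_i(t,b_{-i})=1\}$. The mechanism $\mathcal M^F$ is an $\mathcal M_I^F$ of highest objective among all $I$ with $|I|\le k$. Let $\mathcal M^{F,+}$ be defined in the same way, except that an ad with $a_i<0$ is never displayed (its slot is left empty). **Theorem.** For $3$ items and $2$ slots: 1. if the contributions of ads are nonnegative, i.e. $\alpha_i^A\phi_i(t)+\gamma_i^A\ge0$ for all $i$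 and all $t\in[0,B_i]$, then $\mathcal M^F$ is $(4/5)^3$-approximate; 2. without this assumption, $\mathcal M^{F,+}$ is $(4/5)^3$-approximate. (If all contributions of ads are nonnegative, the two mechanisms coincide.) -/

import Mathlib

open MeasureTheory ProbabilityTheory Set

/-- An instance of the merging problem with `n` items: click-through rates and user-experience
effects of the ad form (`A`) and of the organic form (`O`) of each item, and for each item the
density `f i` of the distribution of its owner's bid, which is regular with support `[0, B i]`. -/
structure MergingInstance (n : ℕ) where
  /-- click-through rates of the ad forms -/
  αA : Fin n → ℝ
  /-- click-through rates of the organic forms -/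
  αO : Fin n → ℝ
  /-- user-experience effects of the ad forms -/
  γA : Fin n → ℝ
  /-- user-experience effects of the organic forms -/
  γO : Fin n → ℝ
  /-- upper ends of the bid supports -/
  B : Fin n → ℝ
  /-- bid densities -/
  f : Fin n → ℝ → ℝ
  αA_nonneg : ∀ i, 0 ≤ αA i
  αA_lt_αO : ∀ i, αA i < αO i
  αO_le_one : ∀ i, αO i ≤ 1
  γA_nonneg : ∀ i, 0 ≤ γA i
  γA_le_γO : ∀ i, γA i ≤ γO i
  f_measurable : ∀ i, Measurable (f i)
  f_pos : ∀ i, ∀ b ∈ Ico 0 (B i), 0 < f i b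
  f_nonneg : ∀ i b, 0 ≤ f i b
  f_support : ∀ i, ∀ b ∉ Icc 0 (B i), f i b = 0
  f_lintegral : ∀ i, ∫⁻ b, ENNReal.ofReal (f i b) = 1
  /-- regularity: the virtual value `b - (1 - F i b) / f i b` is non-decreasing on `[0, B i]`,
  where `F i` is the cumulative distribution function -/
  regular : ∀ i, MonotoneOn
    (fun b => b - (1 - cdf (volume.withDensity fun t => ENNReal.ofReal (f i t)) b) / f i b)
    (Icc 0 (B i))

/-- A merging mechanism: `x b i = 1` if item `i` is displayed as an ad under the bid profile `b`,
`y b i = 1` if it is displayed as an organic item, and `p b i` is the payment per click on the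
ad. -/
structure Mechanism (n : ℕ) where
  x : (Fin n → ℝ) → Fin n → ℝ
  y : (Fin n → ℝ) → Fin n → ℝ
  p : (Fin n → ℝ) → Fin n → ℝ
  x_eq : ∀ b i, x b i = 0 ∨ x b i = 1
  y_eq : ∀ b i, y b i = 0 ∨ y b i = 1
  p_eq_zero : ∀ b i, x b i = 0 → p b i = 0

namespace MergingInstance

variable {n : ℕ} (S : MergingInstance n)

/-- The distribution of the bid of owner `i`. -/
noncomputable def bidLaw (i : Fin n) : Measure ℝ :=
  volume.withDensity fun t => ENNReal.ofReal (S.f i t)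

/-- The distribution of the bid profile: the bids are independent. -/
noncomputable def profileLaw : Measure (Fin n → ℝ) :=
  Measure.pi S.bidLaw

/-- The possible bid profiles. -/
def profiles : Set (Fin n → ℝ) :=
  {b | ∀ i, b i ∈ Icc 0 (S.B i)}

/-- Myerson's virtual value of owner `i`. -/
noncomputable def virtualValue (i : Fin n) (t : ℝ) : ℝ :=
  t - (1 - cdf (S.bidLaw i) t) / S.f i t

/-- The contribution `a i` of the ad form of item `i` when its owner bids `t`. -/
noncomputable def adValue (i : Fin n) (t : ℝ) : ℝ :=
  S.virtualValue i t * S.αA i + S.γA i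

/-- The contribution `o i` of the organic form of item `i`. -/
def orgValue (i : Fin n) : ℝ := S.γO i

/-- The expected click-through rate of item `i`. -/
def clicks (M : Mechanism n) (b : Fin n → ℝ) (i : Fin n) : ℝ :=
  M.x b i * S.αA i + M.y b i * S.αO i

/-- The expected payment of owner `i`. -/
def payment (M : Mechanism n) (b : Fin n → ℝ) (i : Fin n) : ℝ :=
  M.p b i * M.x b i * S.αA i

/-- At most `k` items are displayed, each in at most one form. -/
def Feasible (k : ℕ) (M : Mechanism n) : Prop :=
  ∀ b ∈ S.profiles, (∑ i, (M.x b i + M.y b i) ≤ k) ∧ ∀ i, M.x b i + M.y b i ≤ 1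

/-- Incentive compatibility. -/
def IncentiveCompatible (M : Mechanism n) : Prop :=
  ∀ b ∈ S.profiles, ∀ i, ∀ t ∈ Icc 0 (S.B i),
    b i * S.clicks M (Function.update b i t) i - S.payment M (Function.update b i t) i ≤
      b i * S.clicks M b i - S.payment M b i

/-- Individual rationality. -/
def IndividuallyRational (M : Mechanism n) : Prop :=
  ∀ b ∈ S.profiles, ∀ i, M.p b i ≤ b i

/-- The total expected payment under a bid profile. -/
def totalPayment (M : Mechanism n) (b : Fin n → ℝ) : ℝ :=
  ∑ i, S.payment M b i

/-- The total user experience under a bid profile. -/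
def totalExperience (M : Mechanism n) (b : Fin n → ℝ) : ℝ :=
  ∑ i, (M.x b i * S.γA i + M.y b i * S.γO i)

/-- The objective of the platform: expected revenue plus expected user experience. -/
noncomputable def objective (M : Mechanism n) : ℝ :=
  (∫ b, S.totalPayment M b ∂S.profileLaw) + ∫ b, S.totalExperience M b ∂S.profileLaw

/-- The mechanisms over which the platform optimizes when there are `k` slots. The first four
conditions make the two expectations in the objective meaningful. -/
structure Admissible (k : ℕ) (M : Mechanism n) : Prop where
  x_measurable : Measurable M.x
  y_measurable : Measurable M.y
  p_measurable : Measurable M.p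
  revenue_integrable : Integrable (S.totalPayment M) S.profileLaw
  feasible : S.Feasible k M
  incentiveCompatible : S.IncentiveCompatible M
  individuallyRational : S.IndividuallyRational M

/-- `M` is a `τ`-approximate mechanism: it is an admissible mechanism whose objective is at least
`τ` times the objective of every admissible mechanism, hence at least `τ` times the optimum. -/
def IsApproximate (k : ℕ) (τ : ℝ) (M : Mechanism n) : Prop :=
  S.Admissible k M ∧ ∀ M' : Mechanism n, S.Admissible k M' → τ * S.objective M' ≤ S.objective M

open Classical in
/-- The mechanism with given allocation rules for ads and organic items in which every displayed
ad pays its critical bid, the infimum of the bids at which it would be displayed. -/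
noncomputable def criticalMechanism (ad org : (Fin n → ℝ) → Fin n → Prop) : Mechanism n where
  x b i := if ad b i then 1 else 0
  y b i := if org b i then 1 else 0
  p b i := if ad b i then sInf {t | t ∈ Icc 0 (S.B i) ∧ ad (Function.update b i t) i} else 0
  x_eq b i := by split_ifs <;> simp
  y_eq b i := by split_ifs <;> simp
  p_eq_zero b i h := by
    by_cases hb : ad b i
    · simp [hb] at h
    · simp [hb]

open Classical in
/-- The contributions when the items in `I` take part in organic form and the others as ads. -/
noncomputable def fixValue (I : Finset (Fin n)) (b : Fin n → ℝ) (i : Fin n) : ℝ :=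
  if i ∈ I then S.orgValue i else S.adValue i (b i)

open Classical in
/-- Item `i` is among the `k` items of highest contribution, ties being broken in favour of the
smaller index. Without ties this says that its contribution exceeds the `(k+1)`-st largest one. -/
def FixSelected (k : ℕ) (I : Finset (Fin n)) (b : Fin n → ℝ) (i : Fin n) : Prop :=
  (Finset.univ.filter fun j => S.fixValue I b i < S.fixValue I b j ∨
    (S.fixValue I b j = S.fixValue I b i ∧ j < i)).card < k

/-- The mechanism G-FIX-`I`: the items in `I` take part in organic form only, the others as ads
only, and the `k` items of highest contribution are displayed. -/
noncomputable def fixMechanism (k : ℕ) (I : Finset (Fin n)) : Mechanism n :=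
  S.criticalMechanism
    (fun b i => i ∉ I ∧ S.FixSelected k I b i)
    (fun b i => i ∈ I ∧ S.FixSelected k I b i)

/-- The variant of G-FIX-`I` in which an ad of negative contribution is never displayed, its slot
being left empty. -/
noncomputable def fixMechanismNonneg (k : ℕ) (I : Finset (Fin n)) : Mechanism n :=
  S.criticalMechanism
    (fun b i => i ∉ I ∧ S.FixSelected k I b i ∧ 0 ≤ S.adValue i (b i))
    (fun b i => i ∈ I ∧ S.FixSelected k I b i)

/-- `M` is a mechanism of highest objective in the family `m I`, `|I| ≤ k`. -/
def IsBestOf (k : ℕ) (m : Finset (Fin n) → Mechanism n) (M : Mechanism n) : Prop :=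
  ∃ I : Finset (Fin n), I.card ≤ k ∧ M = m I ∧
    ∀ J : Finset (Fin n), J.card ≤ k → S.objective (m J) ≤ S.objective (m I)

/-- A best mechanism of such a family exists. -/
theorem exists_isBestOf (k : ℕ) (m : Finset (Fin n) → Mechanism n) : ∃ M, S.IsBestOf k m M := by
  obtain ⟨I, hI, h⟩ := Finset.exists_max_image
    ((Finset.univ : Finset (Finset (Fin n))).filter fun I => I.card ≤ k)
    (fun I => S.objective (m I)) ⟨∅, by simp⟩
  refine ⟨m I, I, by simpa using hI, rfl, fun J hJ => h J (by simpa using hJ)⟩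

/-- `M` is the generalized fix mechanism for `k` slots (unique up to ties in the objective). -/
def IsGFix (k : ℕ) (M : Mechanism n) : Prop :=
  S.IsBestOf k (S.fixMechanism k) M

/-- `M` is the generalized fix mechanism for `k` slots without ads of negative contribution. -/
def IsGFixNonneg (k : ℕ) (M : Mechanism n) : Prop :=
  S.IsBestOf k (S.fixMechanismNonneg k) M

end MergingInstance

/-!
The approximation factor obtained is `k / (k + 1)` for `k + 1` items and `k` slots, which is `2 / 3`
for three items and two slots. Write `o i` for the organic contribution of item `i`, `a i` for the
contribution of its ad, and `m i = E[max (a i) 0]` (`adOptimum`).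

*Upper bound* (`Admissible.objective_le`). Fix an item and the bids of all other owners. If some
report of the owner leads to an organic display, this display is free, so by incentive compatibility
no report leads to a positive payment, and the item is worth at most `o i`
(`Admissible.itemValue_le_of_organic`). Otherwise the mechanism posts a price for the ad, and
Myerson's identity bounds the value of the item by `m i`
(`Admissible.integral_itemValue_le_of_not_organic`). Hence no mechanism has an objective above
`∑ i, max (o i) (m i)`, whatever the number of slots.

*Lower bound* (`sum_erase_formValue_le_objective`). Monotone display rules with critical payments
are admissible, and by Myerson's identity their objective is the expected contribution of the
displayed items (`IsImplementable.admissible`, `IsImplementable.objective_eq`). The mechanism of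
G-FIX-`I` leaves out the single item of least contribution, so it does at least as well as leaving
out any item `l` chosen in advance, which yields the sum of `o i` over the `i ≠ l` in `I` and of
`m i` over the `i ≠ l` outside `I`.

Choosing `l` with the least `max (o l) (m l)`, and for `I` the items `i ≠ l` with `m i ≤ o i`, of
which there are at most `k`, gives the fraction `k / (k + 1)` of the upper bound
(`isApproximate_of_isBestOf`).
-/

namespace MergingInstance

variable {n : ℕ} (S : MergingInstance n)

/-! ### The bid distributions and the virtual value -/

instance isProbabilityMeasure_bidLaw (i : Fin n) : IsProbabilityMeasure (S.bidLaw i) :=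
  ⟨by simpa [bidLaw] using S.f_lintegral i⟩

instance isProbabilityMeasure_profileLaw : IsProbabilityMeasure S.profileLaw := by
  unfold profileLaw; infer_instance

theorem bidLaw_absolutelyContinuous (i : Fin n) : S.bidLaw i ≪ volume :=
  withDensity_absolutelyContinuous _ _

theorem ae_bidLaw_ne (i : Fin n) (c : ℝ) : ∀ᵐ t ∂S.bidLaw i, t ≠ c :=
  (S.bidLaw_absolutelyContinuous i).ae_le (Measure.ae_ne volume c)

theorem ae_bidLaw_mem_Icc (i : Fin n) : ∀ᵐ t ∂S.bidLaw i, t ∈ Icc 0 (S.B i) := by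
  rw [ae_iff]
  change S.bidLaw i (Icc 0 (S.B i))ᶜ = 0
  rw [bidLaw, withDensity_apply _ measurableSet_Icc.compl]
  refine setLIntegral_eq_zero measurableSet_Icc.compl fun t ht => ?_
  simp [S.f_support i t ht]

theorem B_nonneg (i : Fin n) : 0 ≤ S.B i := by
  obtain ⟨t, ht⟩ := (S.ae_bidLaw_mem_Icc i).exists
  exact ht.1.trans ht.2

theorem B_mem_Icc (i : Fin n) : S.B i ∈ Icc 0 (S.B i) := ⟨S.B_nonneg i, le_rfl⟩

theorem measurable_virtualValue (i : Fin n) : Measurable (S.virtualValue i) :=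
  measurable_id.sub ((measurable_const.sub (monotone_cdf _).measurable).div (S.f_measurable i))

theorem measurable_adValue (i : Fin n) : Measurable (S.adValue i) :=
  ((S.measurable_virtualValue i).mul_const _).add_const _

theorem adValue_monotoneOn (i : Fin n) : MonotoneOn (S.adValue i) (Icc 0 (S.B i)) := by
  intro s hs t ht hst
  have h : S.virtualValue i s ≤ S.virtualValue i t := S.regular i hs ht hst
  exact add_le_add_left (mul_le_mul_of_nonneg_right h (S.αA_nonneg i)) _

theorem one_sub_cdf_bidLaw (i : Fin n) (s : ℝ) :
    1 - cdf (S.bidLaw i) s = (S.bidLaw i).real (Ioi s) := by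
  rw [cdf_eq_real, ← probReal_compl_eq_one_sub measurableSet_Iic, compl_Iic]

theorem bidLaw_real_Ioi_eq_zero (i : Fin n) {s : ℝ} (hs : S.B i ≤ s) :
    (S.bidLaw i).real (Ioi s) = 0 := by
  rw [measureReal_eq_zero_iff, measure_eq_zero_iff_ae_notMem]
  filter_upwards [S.ae_bidLaw_mem_Icc i] with t ht h
  exact absurd (hs.trans_lt h) (not_lt.2 ht.2)

theorem integrable_bidLaw_of_bounded {i : Fin n} {g : ℝ → ℝ} (hg : Measurable g) {C : ℝ}
    (hC : ∀ t ∈ Icc 0 (S.B i), |g t| ≤ C) : Integrable g (S.bidLaw i) := by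
  refine Integrable.of_bound hg.aestronglyMeasurable C ?_
  filter_upwards [S.ae_bidLaw_mem_Icc i] with t ht using hC t ht

theorem integrable_id_bidLaw (i : Fin n) : Integrable (fun t => t) (S.bidLaw i) :=
  S.integrable_bidLaw_of_bounded measurable_id fun t ht => by
    rw [abs_of_nonneg ht.1]; exact ht.2

theorem bidLaw_eq_withDensity (i : Fin n) :
    S.bidLaw i = volume.withDensity fun t => ((S.f i t).toNNReal : ENNReal) := rfl

/-- The density cancels in the inverse hazard rate and leaves the tail. The upper end of the support
is excluded, as the density may vanish there. -/
theorem density_mul_inverseHazard (i : Fin n) {t : ℝ} (ht : t ≠ S.B i) :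
    (S.f i t).toNNReal • ((Ici (0 : ℝ)).indicator (fun t => (1 - cdf (S.bidLaw i) t) / S.f i t) t) =
      (Ici 0).indicator (fun t => (S.bidLaw i).real (Ioi t)) t := by
  rw [NNReal.smul_def, Real.coe_toNNReal _ (S.f_nonneg i t), smul_eq_mul]
  by_cases h0 : t ∈ Ici 0
  · simp only [indicator_of_mem h0]
    rw [one_sub_cdf_bidLaw]
    rcases lt_or_gt_of_ne ht with h | h
    · exact mul_div_cancel₀ _ (S.f_pos i t ⟨h0, h⟩).ne'
    · rw [S.bidLaw_real_Ioi_eq_zero i h.le]; simp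
  · simp [indicator_of_notMem h0]

theorem measurable_tail (i : Fin n) : Measurable fun t => (S.bidLaw i).real (Ioi t) := by
  simp_rw [← one_sub_cdf_bidLaw]
  exact measurable_const.sub (monotone_cdf _).measurable

theorem integrableOn_tail (i : Fin n) {c : ℝ} :
    IntegrableOn (fun t => (S.bidLaw i).real (Ioi t)) (Ici c) := by
  have h : IntegrableOn (fun t => (S.bidLaw i).real (Ioi t)) (Icc c (S.B i)) :=
    Measure.integrableOn_of_bounded (M := 1) (by simp) (S.measurable_tail i).aestronglyMeasurable
      (Filter.Eventually.of_forall fun t => by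
        rw [Real.norm_of_nonneg measureReal_nonneg]; exact measureReal_le_one)
  refine IntegrableOn.congr_fun (h.integrable_indicator measurableSet_Icc).integrableOn
    (fun t ht => ?_) measurableSet_Ici
  by_cases hB : t ≤ S.B i
  · exact indicator_of_mem (show t ∈ Icc c (S.B i) from ⟨ht, hB⟩) _
  · rw [indicator_of_notMem (show t ∉ Icc c (S.B i) from fun h => hB h.2),
      S.bidLaw_real_Ioi_eq_zero i (not_le.1 hB).le]

theorem integrable_inverseHazard (i : Fin n) :
    Integrable ((Ici (0 : ℝ)).indicator fun t => (1 - cdf (S.bidLaw i) t) / S.f i t)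
      (S.bidLaw i) := by
  rw [bidLaw_eq_withDensity, integrable_withDensity_iff_integrable_smul
    (S.f_measurable i).real_toNNReal]
  refine ((S.integrableOn_tail i (c := 0)).integrable_indicator measurableSet_Ici).congr ?_
  filter_upwards [Measure.ae_ne volume (S.B i)] with t ht using
    (S.density_mul_inverseHazard i ht).symm

theorem setIntegral_inverseHazard (i : Fin n) {c : ℝ} (hc : 0 ≤ c) :
    ∫ t in Ici c, (1 - cdf (S.bidLaw i) t) / S.f i t ∂S.bidLaw i =
      ∫ t in Ici c, (S.bidLaw i).real (Ioi t) := by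
  conv_lhs => rw [bidLaw_eq_withDensity]
  rw [setIntegral_withDensity_eq_setIntegral_smul (S.f_measurable i).real_toNNReal _
    measurableSet_Ici, ← bidLaw_eq_withDensity]
  refine setIntegral_congr_ae measurableSet_Ici ?_
  filter_upwards [Measure.ae_ne volume (S.B i)] with t ht htc
  have h := S.density_mul_inverseHazard i ht
  have h0 : t ∈ Ici (0 : ℝ) := hc.trans htc
  rwa [indicator_of_mem h0, indicator_of_mem h0] at h

theorem integrable_virtualValue (i : Fin n) : Integrable (S.virtualValue i) (S.bidLaw i) := by
  refine ((S.integrable_id_bidLaw i).sub (S.integrable_inverseHazard i)).congr ?_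
  filter_upwards [S.ae_bidLaw_mem_Icc i] with t ht
  simp [virtualValue, indicator_of_mem (show t ∈ Ici (0 : ℝ) from ht.1)]

theorem integrable_adValue (i : Fin n) : Integrable (S.adValue i) (S.bidLaw i) :=
  ((S.integrable_virtualValue i).mul_const _).add (integrable_const _)

/-- The expected excess of the bid over `c` is the integral of the tail (layer-cake formula). -/
theorem setIntegral_sub_eq_integral_tail (i : Fin n) (c : ℝ) :
    ∫ t in Ici c, (t - c) ∂S.bidLaw i = ∫ t in Ici c, (S.bidLaw i).real (Ioi t) := by
  have h1 : ∫ t in Ici c, (t - c) ∂S.bidLaw i = ∫ t, max (t - c) 0 ∂S.bidLaw i := by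
    rw [← integral_indicator measurableSet_Ici]
    refine integral_congr_ae (Filter.Eventually.of_forall fun t => ?_)
    by_cases h : c ≤ t
    · simp [h]
    · simp [indicator_of_notMem (show t ∉ Ici c from h), (not_le.1 h).le]
  have hint : Integrable (fun t => max (t - c) 0) (S.bidLaw i) :=
    ((S.integrable_id_bidLaw i).sub (integrable_const c)).pos_part
  rw [h1, hint.integral_eq_integral_meas_lt (Filter.Eventually.of_forall fun t => le_max_right _ _),
    integral_Ici_eq_integral_Ioi]
  have h2 := (measurePreserving_add_right volume c).setIntegral_preimage_emb
    (measurableEmbedding_addRight c) (fun t => (S.bidLaw i).real (Ioi t)) (Ioi c)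
  rw [← h2, preimage_add_const_Ioi, sub_self]
  refine setIntegral_congr_fun measurableSet_Ioi fun s hs => ?_
  congr 1
  ext t
  have hs0 : ¬ s < 0 := not_lt.2 (le_of_lt hs)
  simp [hs0, lt_sub_iff_add_lt]

/-- Myerson's identity for a posted price `c`: the virtual value above `c` has the expectation
of the revenue `c * (1 - F c)`. -/
theorem setIntegral_virtualValue (i : Fin n) {c : ℝ} (hc : 0 ≤ c) :
    ∫ t in Ici c, S.virtualValue i t ∂S.bidLaw i = c * (S.bidLaw i).real (Ici c) := by
  have h1 := S.setIntegral_sub_eq_integral_tail i c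
  have h2 : IntegrableOn (fun t => (1 - cdf (S.bidLaw i) t) / S.f i t) (Ici c) (S.bidLaw i) :=
    ((S.integrable_inverseHazard i).integrableOn (s := Ici c)).congr_fun (fun t ht =>
      indicator_of_mem (show t ∈ Ici (0 : ℝ) from hc.trans ht) _) measurableSet_Ici
  unfold virtualValue
  rw [integral_sub (S.integrable_id_bidLaw i).integrableOn h2, S.setIntegral_inverseHazard i hc,
    ← h1, integral_sub (S.integrable_id_bidLaw i).integrableOn (integrable_const c)]
  simp [mul_comm]

theorem setIntegral_adValue (i : Fin n) {c : ℝ} (hc : 0 ≤ c) :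
    ∫ t in Ici c, S.adValue i t ∂S.bidLaw i =
      ∫ _ in Ici c, (c * S.αA i + S.γA i) ∂S.bidLaw i := by
  unfold adValue
  rw [integral_add ((S.integrable_virtualValue i).integrableOn.mul_const _) (integrable_const _),
    integral_mul_const, S.setIntegral_virtualValue i hc]
  simp
  ring

/-- An up-closed set of bids agrees almost surely with the ray above its infimum. -/
theorem ae_mem_iff_sInf_le (i : Fin n) {T : Set ℝ} (hT : T ⊆ Icc 0 (S.B i)) (hne : T.Nonempty)
    (hup : ∀ s ∈ T, ∀ t ∈ Icc 0 (S.B i), s ≤ t → t ∈ T) :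
    ∀ᵐ t ∂S.bidLaw i, t ∈ T ↔ t ∈ Ici (sInf T) := by
  filter_upwards [S.ae_bidLaw_mem_Icc i, S.ae_bidLaw_ne i (sInf T)] with t ht hne'
  refine ⟨fun h => csInf_le ⟨0, fun s hs => (hT hs).1⟩ h, fun h => ?_⟩
  obtain ⟨s, hs, hst⟩ := exists_lt_of_csInf_lt hne (lt_of_le_of_ne h hne'.symm)
  exact hup s hs t ht hst.le

theorem integrable_indicator_of_upClosed (i : Fin n) {T : Set ℝ} (hT : T ⊆ Icc 0 (S.B i))
    (hup : ∀ s ∈ T, ∀ t ∈ Icc 0 (S.B i), s ≤ t → t ∈ T) {g : ℝ → ℝ}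
    (hg : Integrable g (S.bidLaw i)) : Integrable (T.indicator g) (S.bidLaw i) := by
  rcases T.eq_empty_or_nonempty with rfl | hne
  · simp
  · refine (hg.indicator (measurableSet_Ici (a := sInf T))).congr ?_
    filter_upwards [S.ae_mem_iff_sInf_le i hT hne hup] with t ht
    by_cases h : t ∈ T
    · rw [indicator_of_mem h, indicator_of_mem (ht.1 h)]
    · rw [indicator_of_notMem h, indicator_of_notMem (mt ht.2 h)]

/-- Myerson's identity for the critical bid: an ad shown exactly for the bids in the up-closed set
`T`, at the price `sInf T` per click, has the expected contribution of its virtual value. -/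
theorem integral_indicator_sInf_eq_adValue (i : Fin n) {T : Set ℝ} (hT : T ⊆ Icc 0 (S.B i))
    (hup : ∀ s ∈ T, ∀ t ∈ Icc 0 (S.B i), s ≤ t → t ∈ T) :
    ∫ t, T.indicator (fun _ => sInf T * S.αA i + S.γA i) t ∂S.bidLaw i =
      ∫ t, T.indicator (S.adValue i) t ∂S.bidLaw i := by
  rcases T.eq_empty_or_nonempty with rfl | hne
  · simp
  have hc : 0 ≤ sInf T := le_csInf hne fun s hs => (hT hs).1
  have key : ∀ g : ℝ → ℝ, ∫ t, T.indicator g t ∂S.bidLaw i =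
      ∫ t in Ici (sInf T), g t ∂S.bidLaw i := by
    intro g
    rw [← integral_indicator measurableSet_Ici]
    refine integral_congr_ae ?_
    filter_upwards [S.ae_mem_iff_sInf_le i hT hne hup] with t ht
    by_cases h : t ∈ T
    · rw [indicator_of_mem h, indicator_of_mem (ht.1 h)]
    · rw [indicator_of_notMem h, indicator_of_notMem (mt ht.2 h)]
  rw [key, key, S.setIntegral_adValue i hc]

/-! ### Resampling one bid -/

theorem ae_mem_profiles : ∀ᵐ b ∂S.profileLaw, b ∈ S.profiles := by
  refine ae_all_iff.2 fun i => ?_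
  exact (measurePreserving_eval S.bidLaw i).quasiMeasurePreserving.ae (S.ae_bidLaw_mem_Icc i)

theorem update_mem_profiles {b : Fin n → ℝ} (hb : b ∈ S.profiles) {i : Fin n} {t : ℝ}
    (ht : t ∈ Icc 0 (S.B i)) : Function.update b i t ∈ S.profiles := by
  intro j
  rcases eq_or_ne j i with rfl | h
  · simpa using ht
  · simpa [h] using hb j

theorem measurable_update_pair (i : Fin n) :
    Measurable fun z : (Fin n → ℝ) × ℝ => Function.update z.1 i z.2 := by
  refine measurable_pi_iff.2 fun j => ?_
  rcases eq_or_ne j i with rfl | h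
  · simpa using measurable_snd
  · simp only [Function.update_of_ne h]
    exact (measurable_pi_apply j).comp measurable_fst

/-- Drawing the bid of owner `i` again does not change the distribution of the profile. -/
theorem measurePreserving_update (i : Fin n) :
    MeasurePreserving (fun z : (Fin n → ℝ) × ℝ => Function.update z.1 i z.2)
      (S.profileLaw.prod (S.bidLaw i)) S.profileLaw := by
  refine ⟨measurable_update_pair i, ?_⟩
  refine (Measure.pi_eq fun s hs => ?_).symm
  rw [Measure.map_apply (measurable_update_pair i) (MeasurableSet.univ_pi hs)]
  have h : (fun z : (Fin n → ℝ) × ℝ => Function.update z.1 i z.2) ⁻¹' univ.pi s =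
      (univ.pi (Function.update s i univ)) ×ˢ s i := by
    ext z
    simp only [mem_preimage, mem_pi, mem_univ, true_imp_iff, mem_prod]
    constructor
    · refine fun hz => ⟨fun j => ?_, by simpa using hz i⟩
      rcases eq_or_ne j i with rfl | hj
      · simp
      · simpa [hj] using hz j
    · rintro ⟨hz, hi⟩ j
      rcases eq_or_ne j i with rfl | hj
      · simpa using hi
      · simpa [hj] using hz j
  rw [h, Measure.prod_prod, profileLaw, Measure.pi_pi,
    ← Finset.prod_erase_mul _ _ (Finset.mem_univ i), ← Finset.prod_erase_mul Finset.univ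
      (fun j => S.bidLaw j (s j)) (Finset.mem_univ i)]
  simp only [Function.update_self, measure_univ, mul_one]
  congr 1
  refine Finset.prod_congr rfl fun j hj => ?_
  rw [Function.update_of_ne (Finset.ne_of_mem_erase hj)]

theorem integral_profileLaw_eq_integral_update (i : Fin n) {g : (Fin n → ℝ) → ℝ}
    (hg : Integrable g S.profileLaw) :
    Integrable (fun b => ∫ t, g (Function.update b i t) ∂S.bidLaw i) S.profileLaw ∧
    ∫ b, g b ∂S.profileLaw =
      ∫ b, ∫ t, g (Function.update b i t) ∂S.bidLaw i ∂S.profileLaw := by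
  have hmp := S.measurePreserving_update i
  have hint := hmp.integrable_comp_of_integrable hg
  refine ⟨hint.integral_prod_left, ?_⟩
  have h := integral_map hmp.measurable.aemeasurable (f := g)
    (by rw [hmp.map_eq]; exact hg.aestronglyMeasurable)
  rw [hmp.map_eq] at h
  exact h.trans (integral_prod _ hint)

theorem integral_profileLaw_le_of_forall_update (i : Fin n) {g : (Fin n → ℝ) → ℝ}
    (hg : Integrable g S.profileLaw) {C : ℝ}
    (hC : ∀ b ∈ S.profiles, ∫ t, g (Function.update b i t) ∂S.bidLaw i ≤ C) :
    ∫ b, g b ∂S.profileLaw ≤ C := by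
  obtain ⟨h1, h2⟩ := S.integral_profileLaw_eq_integral_update i hg
  rw [h2]
  calc _ ≤ ∫ _, C ∂S.profileLaw := by
        refine integral_mono_ae h1 (integrable_const _) ?_
        filter_upwards [S.ae_mem_profiles] with b hb using hC b hb
    _ = C := by simp

theorem integral_profileLaw_congr_of_forall_update (i : Fin n) {g h : (Fin n → ℝ) → ℝ}
    (hg : Integrable g S.profileLaw) (hh : Integrable h S.profileLaw)
    (hgh : ∀ b ∈ S.profiles, ∫ t, g (Function.update b i t) ∂S.bidLaw i =
      ∫ t, h (Function.update b i t) ∂S.bidLaw i) :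
    ∫ b, g b ∂S.profileLaw = ∫ b, h b ∂S.profileLaw := by
  rw [(S.integral_profileLaw_eq_integral_update i hg).2,
    (S.integral_profileLaw_eq_integral_update i hh).2]
  refine integral_congr_ae ?_
  filter_upwards [S.ae_mem_profiles] with b hb using hgh b hb

end MergingInstance

namespace MergingInstance

variable {n : ℕ} (S : MergingInstance n)

/-! ### The objective splits over the items -/

/-- The value of item `i` to the platform under a bid profile: payment plus user experience. -/
def itemValue (M : Mechanism n) (b : Fin n → ℝ) (i : Fin n) : ℝ :=
  S.payment M b i + (M.x b i * S.γA i + M.y b i * S.γO i)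

theorem αO_nonneg (i : Fin n) : 0 ≤ S.αO i := (S.αA_nonneg i).trans (S.αA_lt_αO i).le

theorem γO_nonneg (i : Fin n) : 0 ≤ S.γO i := (S.γA_nonneg i).trans (S.γA_le_γO i)

theorem _root_.Mechanism.x_nonneg (M : Mechanism n) (b : Fin n → ℝ) (i : Fin n) : 0 ≤ M.x b i := by
  rcases M.x_eq b i with h | h <;> simp [h]

theorem _root_.Mechanism.x_le_one (M : Mechanism n) (b : Fin n → ℝ) (i : Fin n) : M.x b i ≤ 1 := by
  rcases M.x_eq b i with h | h <;> simp [h]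

theorem _root_.Mechanism.y_nonneg (M : Mechanism n) (b : Fin n → ℝ) (i : Fin n) : 0 ≤ M.y b i := by
  rcases M.y_eq b i with h | h <;> simp [h]

theorem _root_.Mechanism.y_le_one (M : Mechanism n) (b : Fin n → ℝ) (i : Fin n) : M.y b i ≤ 1 := by
  rcases M.y_eq b i with h | h <;> simp [h]

theorem payment_le_B {M : Mechanism n} (hM : S.IndividuallyRational M) {b : Fin n → ℝ}
    (hb : b ∈ S.profiles) (i : Fin n) : S.payment M b i ≤ S.B i := by
  have hp : M.p b i ≤ S.B i := (hM b hb i).trans (hb i).2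
  have hα : S.αA i ≤ 1 := (S.αA_lt_αO i).le.trans (S.αO_le_one i)
  have hB := S.B_nonneg i
  have hα0 := S.αA_nonneg i
  unfold payment
  rcases M.x_eq b i with h | h
  · simp [h, hB]
  · rw [h, mul_one]
    calc M.p b i * S.αA i ≤ S.B i * S.αA i := mul_le_mul_of_nonneg_right hp hα0
      _ ≤ S.B i := mul_le_of_le_one_right hB hα

variable {S}

theorem Admissible.measurable_payment {k : ℕ} {M : Mechanism n} (h : S.Admissible k M)
    (i : Fin n) : Measurable fun b => S.payment M b i :=
  (((measurable_pi_apply i).comp h.p_measurable).mul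
    ((measurable_pi_apply i).comp h.x_measurable)).mul_const _

/-- Only the total payment is assumed to be integrable. As every single payment is bounded above,
each of them is integrable, too. -/
theorem Admissible.integrable_payment {k : ℕ} {M : Mechanism n} (h : S.Admissible k M)
    (i : Fin n) : Integrable (fun b => S.payment M b i) S.profileLaw := by
  refine Integrable.mono' (h.revenue_integrable.norm.add (integrable_const (∑ j, S.B j)))
    (h.measurable_payment i).aestronglyMeasurable ?_
  filter_upwards [S.ae_mem_profiles] with b hb
  have hle : ∀ j, S.payment M b j ≤ S.B j := S.payment_le_B h.individuallyRational hb
  have h1 : S.totalPayment M b =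
      ∑ j ∈ Finset.univ.erase i, S.payment M b j + S.payment M b i :=
    (Finset.sum_erase_add _ _ (Finset.mem_univ i)).symm
  have h2 : ∑ j, S.B j = ∑ j ∈ Finset.univ.erase i, S.B j + S.B i :=
    (Finset.sum_erase_add _ _ (Finset.mem_univ i)).symm
  have h3 : ∑ j ∈ Finset.univ.erase i, S.payment M b j ≤ ∑ j ∈ Finset.univ.erase i, S.B j :=
    Finset.sum_le_sum fun j _ => hle j
  have h4 : 0 ≤ ∑ j ∈ Finset.univ.erase i, S.B j := Finset.sum_nonneg fun j _ => S.B_nonneg j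
  have h5 := S.B_nonneg i
  have h6 := neg_abs_le (S.totalPayment M b)
  have h7 := hle i
  have h8 := abs_nonneg (S.totalPayment M b)
  simp only [Real.norm_eq_abs, Pi.add_apply]
  rw [abs_le]
  constructor <;> linarith

theorem Admissible.integrable_experience {k : ℕ} {M : Mechanism n} (h : S.Admissible k M)
    (i : Fin n) :
    Integrable (fun b => M.x b i * S.γA i + M.y b i * S.γO i) S.profileLaw := by
  refine Integrable.add (Integrable.mul_const ?_ _) (Integrable.mul_const ?_ _)
  · refine Integrable.of_bound
      ((measurable_pi_apply i).comp h.x_measurable).aestronglyMeasurable 1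
      (Filter.Eventually.of_forall fun b => ?_)
    rw [Real.norm_of_nonneg (M.x_nonneg b i)]
    exact M.x_le_one b i
  · refine Integrable.of_bound
      ((measurable_pi_apply i).comp h.y_measurable).aestronglyMeasurable 1
      (Filter.Eventually.of_forall fun b => ?_)
    rw [Real.norm_of_nonneg (M.y_nonneg b i)]
    exact M.y_le_one b i

theorem Admissible.integrable_itemValue {k : ℕ} {M : Mechanism n} (h : S.Admissible k M)
    (i : Fin n) : Integrable (fun b => S.itemValue M b i) S.profileLaw :=
  (h.integrable_payment i).add (h.integrable_experience i)

theorem Admissible.objective_eq_sum {k : ℕ} {M : Mechanism n} (h : S.Admissible k M) :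
    S.objective M = ∑ i, ∫ b, S.itemValue M b i ∂S.profileLaw := by
  unfold objective totalPayment totalExperience itemValue
  rw [integral_finsetSum _ fun i _ => h.integrable_payment i,
    integral_finsetSum _ fun i _ => h.integrable_experience i, ← Finset.sum_add_distrib]
  exact Finset.sum_congr rfl fun i _ =>
    (integral_add (h.integrable_payment i) (h.integrable_experience i)).symm

variable (S)

/-! ### The value of one item in any mechanism -/

/-- The expected positive part of the contribution of the ad form of item `i`: the most that the
ad form could yield if there were no competition for slots. -/
noncomputable def adOptimum (i : Fin n) : ℝ :=
  ∫ t, max (S.adValue i t) 0 ∂S.bidLaw i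

/-- Integrability is not required: otherwise the integral is zero by convention, and `0 ≤ C`. -/
theorem integral_bidLaw_le {i : Fin n} {g : ℝ → ℝ} {C : ℝ} (hC : 0 ≤ C)
    (hg : ∀ t ∈ Icc 0 (S.B i), g t ≤ C) : ∫ t, g t ∂S.bidLaw i ≤ C := by
  by_cases hi : Integrable g (S.bidLaw i)
  · calc ∫ t, g t ∂S.bidLaw i ≤ ∫ _, C ∂S.bidLaw i := by
          refine integral_mono_ae hi (integrable_const C) ?_
          filter_upwards [S.ae_bidLaw_mem_Icc i] with t ht using hg t ht
      _ = C := by simp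
  · rwa [integral_undef hi]

theorem integral_indicator_adValue_le_adOptimum (i : Fin n) {T : Set ℝ}
    (hT : T ⊆ Icc 0 (S.B i)) (hup : ∀ s ∈ T, ∀ t ∈ Icc 0 (S.B i), s ≤ t → t ∈ T) :
    ∫ t, T.indicator (S.adValue i) t ∂S.bidLaw i ≤ S.adOptimum i := by
  refine integral_mono (S.integrable_indicator_of_upClosed i hT hup (S.integrable_adValue i))
    (S.integrable_adValue i).pos_part fun t => ?_
  by_cases h : t ∈ T
  · simp [indicator_of_mem h]
  · simp [indicator_of_notMem h]

variable {S}

/-- If an owner can be displayed organically, and hence for free, by some report, then no report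
makes the owner pay, so that the item is worth at most its organic form. -/
theorem Admissible.itemValue_le_of_organic {k : ℕ} {M : Mechanism n} (h : S.Admissible k M)
    {b : Fin n → ℝ} (hb : b ∈ S.profiles) (i : Fin n) {s : ℝ} (hs : s ∈ Icc 0 (S.B i))
    (hy : M.y (Function.update b i s) i = 1) {t : ℝ} (ht : t ∈ Icc 0 (S.B i)) :
    S.itemValue M (Function.update b i t) i ≤ S.γO i := by
  have hbs := S.update_mem_profiles hb hs
  have hbt := S.update_mem_profiles hb ht
  have hx : M.x (Function.update b i s) i = 0 := by
    have h1 := (h.feasible _ hbs).2 i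
    have h2 := M.x_nonneg (Function.update b i s) i
    linarith
  have hic := h.incentiveCompatible _ hbt i s hs
  rw [Function.update_idem, Function.update_self] at hic
  have hc : S.clicks M (Function.update b i s) i = S.αO i := by simp [clicks, hx, hy]
  have hp : S.payment M (Function.update b i s) i = 0 := by simp [payment, hx]
  rw [hc, hp, sub_zero] at hic
  set x := M.x (Function.update b i t) i with hxd
  set y := M.y (Function.update b i t) i with hyd
  have hx0 : 0 ≤ x := M.x_nonneg _ _
  have hy0 : 0 ≤ y := M.y_nonneg _ _
  have hxy : x + y ≤ 1 := (h.feasible _ hbt).2 i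
  have hcl : S.clicks M (Function.update b i t) i ≤ S.αO i := by
    calc x * S.αA i + y * S.αO i ≤ x * S.αO i + y * S.αO i := by
          gcongr; exact (S.αA_lt_αO i).le
      _ = (x + y) * S.αO i := by ring
      _ ≤ S.αO i := mul_le_of_le_one_left (S.αO_nonneg i) hxy
  have hex : x * S.γA i + y * S.γO i ≤ S.γO i := by
    calc x * S.γA i + y * S.γO i ≤ x * S.γO i + y * S.γO i := by
          gcongr; exact S.γA_le_γO i
      _ = (x + y) * S.γO i := by ring
      _ ≤ S.γO i := mul_le_of_le_one_left (S.γO_nonneg i) hxy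
  have hpay := mul_le_mul_of_nonneg_left hcl ht.1
  unfold itemValue
  linarith

/-- If an owner is never displayed organically, incentive compatibility makes the mechanism post a
price, whose revenue Myerson's identity bounds by the positive part of the virtual value. -/
theorem Admissible.integral_itemValue_le_of_not_organic {k : ℕ} {M : Mechanism n}
    (h : S.Admissible k M) {b : Fin n → ℝ} (hb : b ∈ S.profiles) (i : Fin n)
    (hα : 0 < S.αA i) (hy : ∀ t ∈ Icc 0 (S.B i), M.y (Function.update b i t) i = 0) :
    ∫ t, S.itemValue M (Function.update b i t) i ∂S.bidLaw i ≤ S.adOptimum i := by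
  set T : Set ℝ := {t | t ∈ Icc 0 (S.B i) ∧ M.x (Function.update b i t) i = 1} with hTdef
  have hTsub : T ⊆ Icc 0 (S.B i) := fun t ht => ht.1
  have hx0 : ∀ t ∈ Icc 0 (S.B i), t ∉ T → M.x (Function.update b i t) i = 0 := fun t ht hn =>
    (M.x_eq (Function.update b i t) i).resolve_right fun h1 => hn ⟨ht, h1⟩
  have hic : ∀ t ∈ Icc 0 (S.B i), ∀ s ∈ T, (t - M.p (Function.update b i s) i) * S.αA i ≤
      (t - M.p (Function.update b i t) i) * (M.x (Function.update b i t) i * S.αA i) := by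
    intro t ht s hs
    have h1 := h.incentiveCompatible _ (S.update_mem_profiles hb ht) i s hs.1
    rw [Function.update_idem, Function.update_self] at h1
    simp only [clicks, payment, hs.2, hy s hs.1, hy t ht] at h1
    linarith
  have hprice : ∀ s ∈ T, M.p (Function.update b i s) i ≤ s := fun s hs => by
    simpa using h.individuallyRational _ (S.update_mem_profiles hb hs.1) i
  have hlow : ∀ t ∈ Icc 0 (S.B i), t ∉ T → ∀ s ∈ T, t ≤ M.p (Function.update b i s) i := by
    intro t ht hn s hs
    have h1 := hic t ht s hs
    rw [hx0 t ht hn, zero_mul, mul_zero] at h1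
    linarith [nonpos_of_mul_nonpos_left h1 hα]
  have hup : ∀ s ∈ T, ∀ t ∈ Icc 0 (S.B i), s ≤ t → t ∈ T := by
    intro s hs t ht hst
    by_contra hn
    have h1 : t = s := le_antisymm ((hlow t ht hn s hs).trans (hprice s hs)) hst
    exact hn (h1 ▸ hs)
  have hsame : ∀ s ∈ T, ∀ t ∈ T, M.p (Function.update b i t) i ≤ M.p (Function.update b i s) i := by
    intro s hs t ht
    have h1 := hic t ht.1 s hs
    rw [ht.2, one_mul] at h1
    linarith [le_of_mul_le_mul_right h1 hα]
  -- All displayed bids pay the same price, so it is at most the lowest of these bids.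
  have hpt : ∀ t ∈ T, M.p (Function.update b i t) i ≤ sInf T := fun t ht =>
    le_csInf ⟨t, ht⟩ fun s hs => (hsame s hs t ht).trans (hprice s hs)
  by_cases hi : Integrable (fun t => S.itemValue M (Function.update b i t) i) (S.bidLaw i)
  · calc ∫ t, S.itemValue M (Function.update b i t) i ∂S.bidLaw i
        ≤ ∫ t, T.indicator (fun _ => sInf T * S.αA i + S.γA i) t ∂S.bidLaw i := by
          refine integral_mono_ae hi (S.integrable_indicator_of_upClosed i hTsub hup
            (integrable_const _)) ?_
          filter_upwards [S.ae_bidLaw_mem_Icc i] with t ht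
          by_cases hm : t ∈ T
          · rw [indicator_of_mem hm]
            simp only [itemValue, payment, hm.2, hy t ht]
            have := mul_le_mul_of_nonneg_right (hpt t hm) hα.le
            linarith
          · rw [indicator_of_notMem hm]
            simp [itemValue, payment, hx0 t ht hm, hy t ht]
      _ = ∫ t, T.indicator (S.adValue i) t ∂S.bidLaw i :=
          S.integral_indicator_sInf_eq_adValue i hTsub hup
      _ ≤ S.adOptimum i := S.integral_indicator_adValue_le_adOptimum i hTsub hup
  · -- Without integrability the integral is zero by convention.
    rw [integral_undef hi]
    exact integral_nonneg fun t => le_max_right _ _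

theorem Admissible.integral_itemValue_update_le {k : ℕ} {M : Mechanism n} (h : S.Admissible k M)
    {b : Fin n → ℝ} (hb : b ∈ S.profiles) (i : Fin n) :
    ∫ t, S.itemValue M (Function.update b i t) i ∂S.bidLaw i ≤
      max (S.orgValue i) (S.adOptimum i) := by
  by_cases hy : ∃ s ∈ Icc 0 (S.B i), M.y (Function.update b i s) i = 1
  · obtain ⟨s, hs, hy⟩ := hy
    exact (S.integral_bidLaw_le (S.γO_nonneg i) fun t ht =>
      h.itemValue_le_of_organic hb i hs hy ht).trans (le_max_left _ _)
  have hy0 : ∀ t ∈ Icc 0 (S.B i), M.y (Function.update b i t) i = 0 := fun t ht =>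
    (M.y_eq _ i).resolve_right fun h1 => hy ⟨t, ht, h1⟩
  rcases (S.αA_nonneg i).eq_or_lt with hα | hα
  · -- An ad without clicks brings no revenue, and at most the experience of the organic form.
    refine (S.integral_bidLaw_le (S.γO_nonneg i) fun t ht => ?_).trans (le_max_left _ _)
    have h1 := mul_le_of_le_one_left (S.γA_nonneg i) (M.x_le_one (Function.update b i t) i)
    have h2 := S.γA_le_γO i
    simp only [itemValue, payment, ← hα, hy0 t ht]
    linarith
  · exact (h.integral_itemValue_le_of_not_organic hb i hα hy0).trans (le_max_right _ _)

/-- The upper bound on the optimum: no admissible mechanism gets more from an item than the better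
of its two forms yields without competition. -/
theorem Admissible.objective_le {k : ℕ} {M : Mechanism n} (h : S.Admissible k M) :
    S.objective M ≤ ∑ i, max (S.orgValue i) (S.adOptimum i) := by
  rw [h.objective_eq_sum]
  exact Finset.sum_le_sum fun i _ => S.integral_profileLaw_le_of_forall_update i
    (h.integrable_itemValue i) fun b hb => h.integral_itemValue_update_le hb i

end MergingInstance

namespace MergingInstance

variable {n : ℕ} (S : MergingInstance n)

/-! ### Monotone allocation rules with critical payments -/

/-- Display rules for `k` slots that can be implemented by critical payments: the ad of an owner
stays displayed when only its bid increases, and whether an item is displayed organically does not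
depend on the bid of its owner. -/
structure IsImplementable (k : ℕ) (ad org : (Fin n → ℝ) → Fin n → Prop) : Prop where
  measurableSet_ad : ∀ i, MeasurableSet {b | ad b i}
  measurableSet_org : ∀ i, MeasurableSet {b | org b i}
  not_org_of_ad : ∀ b i, ad b i → ¬ org b i
  displayed_le : ∀ b, ∃ s : Finset (Fin n), s.card ≤ k ∧ ∀ i, ad b i ∨ org b i → i ∈ s
  ad_mono : ∀ b i, ∀ s ∈ Icc 0 (S.B i), ∀ t ∈ Icc 0 (S.B i), s ≤ t →
    ad (Function.update b i s) i → ad (Function.update b i t) i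
  org_update : ∀ b i t, org (Function.update b i t) i ↔ org b i

/-- The bids of owner `i` at which its ad is displayed, given the bids of the others. -/
def winningBids (ad : (Fin n → ℝ) → Fin n → Prop) (b : Fin n → ℝ) (i : Fin n) : Set ℝ :=
  {t | t ∈ Icc 0 (S.B i) ∧ ad (Function.update b i t) i}

open Classical in
/-- The contribution of item `i` in the form in which it is displayed, zero if it is not. -/
noncomputable def displayedValue (ad org : (Fin n → ℝ) → Fin n → Prop) (b : Fin n → ℝ)
    (i : Fin n) : ℝ :=
  (if ad b i then S.adValue i (b i) else 0) + if org b i then S.orgValue i else 0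

theorem winningBids_update (ad : (Fin n → ℝ) → Fin n → Prop) (b : Fin n → ℝ) (i : Fin n) (t : ℝ) :
    S.winningBids ad (Function.update b i t) i = S.winningBids ad b i := by
  simp only [winningBids, Function.update_idem]

theorem criticalMechanism_p (ad org : (Fin n → ℝ) → Fin n → Prop) {b : Fin n → ℝ} {i : Fin n}
    (h : ad b i) : (criticalMechanism S ad org).p b i = sInf (S.winningBids ad b i) := by
  simp [criticalMechanism, h, winningBids]

theorem criticalMechanism_x (ad org : (Fin n → ℝ) → Fin n → Prop) {b : Fin n → ℝ} {i : Fin n}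
    (h : ad b i) : (criticalMechanism S ad org).x b i = 1 := by
  simp [criticalMechanism, h]

theorem criticalMechanism_x_of_not (ad org : (Fin n → ℝ) → Fin n → Prop) {b : Fin n → ℝ}
    {i : Fin n} (h : ¬ ad b i) : (criticalMechanism S ad org).x b i = 0 := by
  simp [criticalMechanism, h]

theorem criticalMechanism_y (ad org : (Fin n → ℝ) → Fin n → Prop) {b : Fin n → ℝ} {i : Fin n}
    (h : org b i) : (criticalMechanism S ad org).y b i = 1 := by
  simp [criticalMechanism, h]

theorem criticalMechanism_y_of_not (ad org : (Fin n → ℝ) → Fin n → Prop) {b : Fin n → ℝ}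
    {i : Fin n} (h : ¬ org b i) : (criticalMechanism S ad org).y b i = 0 := by
  simp [criticalMechanism, h]

theorem winningBids_subset (ad : (Fin n → ℝ) → Fin n → Prop) (b : Fin n → ℝ) (i : Fin n) :
    S.winningBids ad b i ⊆ Icc 0 (S.B i) := fun _ h => h.1

theorem sInf_winningBids_le (ad : (Fin n → ℝ) → Fin n → Prop) {b : Fin n → ℝ} {i : Fin n} {t : ℝ}
    (ht : t ∈ S.winningBids ad b i) : sInf (S.winningBids ad b i) ≤ t :=
  csInf_le ⟨0, fun _ h => h.1.1⟩ ht

theorem sInf_winningBids_nonneg (ad : (Fin n → ℝ) → Fin n → Prop) (b : Fin n → ℝ) (i : Fin n) :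
    0 ≤ sInf (S.winningBids ad b i) := Real.sInf_nonneg fun _ h => h.1.1

theorem mem_winningBids_iff {ad : (Fin n → ℝ) → Fin n → Prop} {b : Fin n → ℝ}
    (hb : b ∈ S.profiles) {i : Fin n} : b i ∈ S.winningBids ad b i ↔ ad b i := by
  have hbi : 0 ≤ b i ∧ b i ≤ S.B i := hb i
  simp [winningBids, hbi]

theorem criticalMechanism_individuallyRational (ad org : (Fin n → ℝ) → Fin n → Prop) :
    S.IndividuallyRational (criticalMechanism S ad org) := by
  intro b hb i
  by_cases ha : ad b i
  · rw [S.criticalMechanism_p ad org ha]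
    exact S.sInf_winningBids_le ad ((S.mem_winningBids_iff hb).2 ha)
  · rw [(criticalMechanism S ad org).p_eq_zero b i (S.criticalMechanism_x_of_not ad org ha)]
    exact (hb i).1

theorem criticalMechanism_payment_nonneg (ad org : (Fin n → ℝ) → Fin n → Prop) (b : Fin n → ℝ)
    (i : Fin n) :
    0 ≤ S.payment (criticalMechanism S ad org) b i := by
  unfold payment
  by_cases ha : ad b i
  · rw [S.criticalMechanism_p ad org ha]
    exact mul_nonneg (mul_nonneg (S.sInf_winningBids_nonneg ad b i) (Mechanism.x_nonneg _ _ _))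
      (S.αA_nonneg i)
  · simp [S.criticalMechanism_x_of_not ad org ha]

namespace IsImplementable

variable {S} {k : ℕ} {ad org : (Fin n → ℝ) → Fin n → Prop} (h : S.IsImplementable k ad org)
include h

theorem winningBids_upClosed (b : Fin n → ℝ) (i : Fin n) :
    ∀ s ∈ S.winningBids ad b i, ∀ t ∈ Icc 0 (S.B i), s ≤ t → t ∈ S.winningBids ad b i :=
  fun s hs t ht hst => ⟨ht, h.ad_mono b i s hs.1 t ht hst hs.2⟩

open Classical in
/-- As the winning bids are up-closed, the critical bid can be read off from their length. This
makes it a measurable function of the profile. -/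
theorem sInf_winningBids_eq (b : Fin n → ℝ) (i : Fin n) :
    sInf (S.winningBids ad b i) = if ad (Function.update b i (S.B i)) i then
      S.B i - (volume (S.winningBids ad b i)).toReal else 0 := by
  split_ifs with hB
  · have hBm : S.B i ∈ S.winningBids ad b i := ⟨S.B_mem_Icc i, hB⟩
    have hc := S.sInf_winningBids_le ad hBm
    have hv : volume (S.winningBids ad b i) =
        ENNReal.ofReal (S.B i - sInf (S.winningBids ad b i)) := by
      refine le_antisymm ?_ ?_
      · rw [← Real.volume_Icc]
        exact measure_mono fun t ht => ⟨S.sInf_winningBids_le ad ht, ht.1.2⟩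
      · rw [← Real.volume_Ioc]
        refine measure_mono fun t ht => ?_
        obtain ⟨s, hs, hst⟩ := exists_lt_of_csInf_lt ⟨_, hBm⟩ ht.1
        exact h.winningBids_upClosed b i s hs t ⟨hs.1.1.trans hst.le, ht.2⟩ hst.le
    rw [hv, ENNReal.toReal_ofReal (sub_nonneg.2 hc)]
    ring
  · have he : S.winningBids ad b i = ∅ := by
      refine eq_empty_of_forall_notMem fun t ht => hB ?_
      exact h.ad_mono b i t ht.1 _ (S.B_mem_Icc i) ht.1.2 ht.2
    rw [he, Real.sInf_empty]

theorem measurable_sInf_winningBids (i : Fin n) :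
    Measurable fun b => sInf (S.winningBids ad b i) := by
  classical
  simp_rw [h.sInf_winningBids_eq]
  refine Measurable.ite ?_ (measurable_const.sub (Measurable.ennreal_toReal ?_)) measurable_const
  · exact (measurable_update_pair i).comp (measurable_id.prodMk measurable_const)
      (h.measurableSet_ad i)
  · have hs : MeasurableSet {z : (Fin n → ℝ) × ℝ |
        z.2 ∈ Icc 0 (S.B i) ∧ ad (Function.update z.1 i z.2) i} :=
      (measurable_snd measurableSet_Icc).inter (measurable_update_pair i (h.measurableSet_ad i))
    exact measurable_measure_prodMk_left hs

theorem measurable_x : Measurable (criticalMechanism S ad org).x := by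
  classical
  refine measurable_pi_iff.2 fun i => ?_
  simp only [criticalMechanism]
  convert! Measurable.ite (h.measurableSet_ad i) measurable_const measurable_const

theorem measurable_y : Measurable (criticalMechanism S ad org).y := by
  classical
  refine measurable_pi_iff.2 fun i => ?_
  simp only [criticalMechanism]
  convert! Measurable.ite (h.measurableSet_org i) measurable_const measurable_const

theorem measurable_p : Measurable (criticalMechanism S ad org).p := by
  classical
  refine measurable_pi_iff.2 fun i => ?_
  simp only [criticalMechanism]
  exact Measurable.ite (p := fun b => ad b i) (h.measurableSet_ad i)
    (h.measurable_sInf_winningBids i) measurable_const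

theorem feasible : S.Feasible k (criticalMechanism S ad org) := by
  classical
  intro b _
  have hxy : ∀ i, (criticalMechanism S ad org).x b i + (criticalMechanism S ad org).y b i =
      if ad b i ∨ org b i then 1 else 0 := by
    intro i
    by_cases ha : ad b i
    · simp [criticalMechanism, ha, h.not_org_of_ad b i ha]
    · simp [criticalMechanism, ha]
  constructor
  · simp_rw [hxy]
    rw [Finset.sum_boole]
    obtain ⟨s, hs, hmem⟩ := h.displayed_le b
    have hcard : (Finset.univ.filter fun i => ad b i ∨ org b i).card ≤ k :=
      (Finset.card_le_card fun i hi => hmem i (Finset.mem_filter.1 hi).2).trans hs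
    exact_mod_cast hcard
  · intro i
    rw [hxy]
    split_ifs <;> norm_num

theorem incentiveCompatible : S.IncentiveCompatible (criticalMechanism S ad org) := by
  intro b hb i t ht
  by_cases ho : org b i
  · -- The owner is displayed organically, whatever the report.
    have hot := (h.org_update b i t).2 ho
    have ha : ¬ ad b i := fun ha => h.not_org_of_ad b i ha ho
    have hat : ¬ ad (Function.update b i t) i := fun ha => h.not_org_of_ad _ i ha hot
    simp [clicks, payment, S.criticalMechanism_x_of_not ad org ha,
      S.criticalMechanism_x_of_not ad org hat, S.criticalMechanism_y ad org ho,
      S.criticalMechanism_y ad org hot]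
  have hot : ¬ org (Function.update b i t) i := mt (h.org_update b i t).1 ho
  have hwin : ∀ s, ad (Function.update b i s) i →
      (criticalMechanism S ad org).p (Function.update b i s) i = sInf (S.winningBids ad b i) := by
    intro s hs
    rw [S.criticalMechanism_p ad org hs, winningBids_update]
  by_cases ha : ad b i <;> by_cases hat : ad (Function.update b i t) i
  · have hp := hwin (b i) (by rwa [Function.update_eq_self])
    rw [Function.update_eq_self] at hp
    simp [clicks, payment, S.criticalMechanism_x ad org ha, S.criticalMechanism_x ad org hat,
      S.criticalMechanism_y_of_not ad org ho, S.criticalMechanism_y_of_not ad org hot, hp,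
      hwin t hat]
  · have hp := S.criticalMechanism_p ad org ha
    have hle := S.sInf_winningBids_le ad ((S.mem_winningBids_iff hb).2 ha)
    simp only [clicks, payment, S.criticalMechanism_x ad org ha,
      S.criticalMechanism_x_of_not ad org hat,
      S.criticalMechanism_y_of_not ad org ho, S.criticalMechanism_y_of_not ad org hot, hp]
    linarith [mul_le_mul_of_nonneg_right hle (S.αA_nonneg i)]
  · have hle : b i ≤ sInf (S.winningBids ad b i) := by
      refine le_csInf ⟨t, ht, hat⟩ fun s hs => ?_
      by_contra hlt
      exact ha ((S.mem_winningBids_iff hb).1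
        (h.winningBids_upClosed b i s hs _ (hb i) (not_le.1 hlt).le))
    simp only [clicks, payment, S.criticalMechanism_x_of_not ad org ha,
      S.criticalMechanism_x ad org hat,
      S.criticalMechanism_y_of_not ad org ho, S.criticalMechanism_y_of_not ad org hot, hwin t hat]
    linarith [mul_le_mul_of_nonneg_right hle (S.αA_nonneg i)]
  · simp [clicks, payment, S.criticalMechanism_x_of_not ad org ha,
      S.criticalMechanism_x_of_not ad org hat,
      S.criticalMechanism_y_of_not ad org ho, S.criticalMechanism_y_of_not ad org hot]

/-- Monotone rules with critical payments are an admissible mechanism. -/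
theorem admissible : S.Admissible k (criticalMechanism S ad org) where
  x_measurable := h.measurable_x
  y_measurable := h.measurable_y
  p_measurable := h.measurable_p
  revenue_integrable := by
    unfold totalPayment
    refine integrable_finsetSum _ fun i _ => Integrable.of_bound (Measurable.aestronglyMeasurable
      ((((measurable_pi_apply i).comp h.measurable_p).mul
        ((measurable_pi_apply i).comp h.measurable_x)).mul_const _)) (S.B i) ?_
    filter_upwards [S.ae_mem_profiles] with b hb
    have h1 := S.payment_le_B (S.criticalMechanism_individuallyRational ad org) hb i
    have h2 := S.criticalMechanism_payment_nonneg ad org b i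
    rw [Real.norm_of_nonneg h2]
    exact h1
  feasible := h.feasible
  incentiveCompatible := h.incentiveCompatible
  individuallyRational := S.criticalMechanism_individuallyRational ad org

theorem integrable_displayedValue (i : Fin n) :
    Integrable (fun b => S.displayedValue ad org b i) S.profileLaw := by
  classical
  have h1 : Integrable (fun b : Fin n → ℝ => S.adValue i (b i)) S.profileLaw :=
    (measurePreserving_eval S.bidLaw i).integrable_comp_of_integrable (S.integrable_adValue i)
  refine ((h1.indicator (h.measurableSet_ad i)).add
    ((integrable_const (S.orgValue i)).indicator (h.measurableSet_org i))).congr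
    (Filter.Eventually.of_forall fun b => ?_)
  simp [displayedValue, indicator_apply]

/-- With critical payments, an item is worth its contribution: by Myerson's identity for ads, and
trivially for organic items. -/
theorem objective_eq : S.objective (criticalMechanism S ad org) =
    ∑ i, ∫ b, S.displayedValue ad org b i ∂S.profileLaw := by
  rw [h.admissible.objective_eq_sum]
  refine Finset.sum_congr rfl fun i _ => S.integral_profileLaw_congr_of_forall_update i
    (h.admissible.integrable_itemValue i) (h.integrable_displayedValue i) fun b _ => ?_
  by_cases ho : org b i
  · refine integral_congr_ae (Filter.Eventually.of_forall fun t => ?_)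
    have hot := (h.org_update b i t).2 ho
    have hat : ¬ ad (Function.update b i t) i := fun ha => h.not_org_of_ad _ i ha hot
    simp [itemValue, payment, displayedValue, S.criticalMechanism_x_of_not ad org hat,
      S.criticalMechanism_y ad org hot, hat, hot, orgValue]
  have hot : ∀ t, ¬ org (Function.update b i t) i := fun t => mt (h.org_update b i t).1 ho
  have key := S.integral_indicator_sInf_eq_adValue i (S.winningBids_subset ad b i)
    (h.winningBids_upClosed b i)
  refine Eq.trans (integral_congr_ae ?_) (key.trans (integral_congr_ae ?_))
  · filter_upwards [S.ae_bidLaw_mem_Icc i] with t ht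
    by_cases ha : ad (Function.update b i t) i
    · rw [indicator_of_mem (show t ∈ S.winningBids ad b i from ⟨ht, ha⟩)]
      simp [itemValue, payment, S.criticalMechanism_p ad org ha, S.criticalMechanism_x ad org ha,
        S.criticalMechanism_y_of_not ad org (hot t), winningBids_update]
    · rw [indicator_of_notMem (show t ∉ S.winningBids ad b i from fun hm => ha hm.2)]
      simp [itemValue, payment, S.criticalMechanism_x_of_not ad org ha,
        S.criticalMechanism_y_of_not ad org (hot t)]
  · filter_upwards [S.ae_bidLaw_mem_Icc i] with t ht
    by_cases ha : ad (Function.update b i t) i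
    · rw [indicator_of_mem (show t ∈ S.winningBids ad b i from ⟨ht, ha⟩)]
      simp [displayedValue, ha, hot t]
    · rw [indicator_of_notMem (show t ∉ S.winningBids ad b i from fun hm => ha hm.2)]
      simp [displayedValue, ha, hot t]

end IsImplementable

end MergingInstance

namespace MergingInstance

/-! ### Selection of the highest contributions -/

section Selection

variable {n : ℕ} (S : MergingInstance n)

theorem measurable_fixValue (I : Finset (Fin n)) (i : Fin n) :
    Measurable fun b => S.fixValue I b i := by
  unfold fixValue
  split_ifs
  · exact measurable_const
  · exact (S.measurable_adValue i).comp (measurable_pi_apply i)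

theorem measurableSet_fixSelected (k : ℕ) (I : Finset (Fin n)) (i : Fin n) :
    MeasurableSet {b | S.FixSelected k I b i} := by
  classical
  unfold FixSelected
  simp only [Finset.card_filter]
  refine measurableSet_lt (Finset.measurable_sum _ fun j _ => ?_) measurable_const
  refine Measurable.ite ?_ measurable_const measurable_const
  exact (measurableSet_lt (S.measurable_fixValue I i) (S.measurable_fixValue I j)).union
    ((measurableSet_eq_fun (S.measurable_fixValue I j) (S.measurable_fixValue I i)).inter
      (MeasurableSet.const _))

theorem fixValue_update_of_ne (I : Finset (Fin n)) (b : Fin n → ℝ) {i j : Fin n} (h : j ≠ i)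
    (t : ℝ) : S.fixValue I (Function.update b i t) j = S.fixValue I b j := by
  simp [fixValue, h]

theorem fixValue_update_of_mem {I : Finset (Fin n)} (b : Fin n → ℝ) {i : Fin n} (h : i ∈ I)
    (t : ℝ) : S.fixValue I (Function.update b i t) = S.fixValue I b := by
  funext j
  rcases eq_or_ne j i with rfl | hj
  · simp [fixValue, h]
  · exact S.fixValue_update_of_ne I b hj t

theorem fixSelected_update_mono {k : ℕ} {I : Finset (Fin n)} (b : Fin n → ℝ) {i : Fin n}
    (hi : i ∉ I) {s t : ℝ} (hs : s ∈ Icc 0 (S.B i)) (ht : t ∈ Icc 0 (S.B i)) (hst : s ≤ t)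
    (h : S.FixSelected k I (Function.update b i s) i) :
    S.FixSelected k I (Function.update b i t) i := by
  classical
  refine lt_of_le_of_lt (Finset.card_le_card fun j hj => ?_) h
  have hle : S.fixValue I (Function.update b i s) i ≤ S.fixValue I (Function.update b i t) i := by
    simpa [fixValue, hi] using S.adValue_monotoneOn i hs ht hst
  simp only [Finset.mem_filter, Finset.mem_univ, true_and] at hj ⊢
  have hji : j ≠ i := by
    rintro rfl
    simp at hj
  rw [S.fixValue_update_of_ne I b hji] at hj ⊢
  rcases hj with hj | ⟨hj, hlt⟩
  · exact Or.inl (hle.trans_lt hj)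
  · rcases hle.eq_or_lt with he | hl
    · exact Or.inr ⟨hj.trans he.symm, hlt⟩
    · exact Or.inl (hj ▸ hl)

end Selection

variable {k : ℕ} (S : MergingInstance (k + 1))

/-- With one slot less than items, exactly one item is left out, and it has the least
contribution. -/
theorem exists_forall_fixSelected_iff_ne (I : Finset (Fin (k + 1))) (b : Fin (k + 1) → ℝ) :
    ∃ j, (∀ i, S.FixSelected k I b i ↔ i ≠ j) ∧ ∀ i, S.fixValue I b j ≤ S.fixValue I b i := by
  classical
  obtain ⟨j, -, hj⟩ := Finset.exists_min_image Finset.univ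
    (fun j => toLex (S.fixValue I b j, OrderDual.toDual j)) ⟨0, Finset.mem_univ _⟩
  have hj' : ∀ i, S.fixValue I b j < S.fixValue I b i ∨
      (S.fixValue I b j = S.fixValue I b i ∧ i ≤ j) := fun i => by
    simpa [Prod.Lex.toLex_le_toLex] using hj i (Finset.mem_univ i)
  refine ⟨j, fun i => ⟨?_, fun hij => ?_⟩, fun i => (hj' i).elim le_of_lt fun h => h.1.le⟩
  · rintro h rfl
    refine absurd h (not_lt.2 ?_)
    have hk : (Finset.univ.erase i).card = k := by simp
    refine hk.symm.le.trans (Finset.card_le_card fun l hl => ?_)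
    simp only [Finset.mem_filter, Finset.mem_univ, true_and]
    exact (hj' l).imp_right fun h => ⟨h.1.symm, lt_of_le_of_ne h.2 (Finset.ne_of_mem_erase hl)⟩
  · have hk : (Finset.univ.erase i).card = k := by simp
    have hji : j ∈ Finset.univ.erase i := by simp [hij.symm]
    refine lt_of_lt_of_eq (lt_of_le_of_lt (Finset.card_le_card fun l hl => ?_)
      (Finset.card_erase_lt_of_mem hji)) hk
    simp only [Finset.mem_filter, Finset.mem_univ, true_and] at hl
    refine Finset.mem_erase.2 ⟨?_, Finset.mem_erase.2 ⟨?_, Finset.mem_univ _⟩⟩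
    · rintro rfl
      rcases hl with hl | ⟨hl, hlt⟩ <;> rcases hj' i with hh | ⟨hh, hle⟩
      · exact lt_asymm hl hh
      · exact hl.ne hh.symm
      · exact hh.ne hl
      · exact absurd hlt (not_lt.2 hle)
    · rintro rfl
      simp at hl

/-- Leaving out the smallest of `k + 1` numbers keeps at least the fraction `k / (k + 1)` of
their sum. -/
theorem div_mul_sum_le_sum_erase (v : Fin (k + 1) → ℝ) {j : Fin (k + 1)} (hj : ∀ i, v j ≤ v i) :
    (k / (k + 1) : ℝ) * ∑ i, v i ≤ ∑ i ∈ Finset.univ.erase j, v i := by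
  have h1 : (k : ℝ) * v j ≤ ∑ i ∈ Finset.univ.erase j, v i := by
    simpa using Finset.card_nsmul_le_sum (Finset.univ.erase j) v (v j) fun i _ => hj i
  have h2 := Finset.sum_erase_add Finset.univ v (Finset.mem_univ j)
  rw [← h2, div_mul_eq_mul_div, div_le_iff₀ (by positivity)]
  linarith

/-! ### The generalized fix mechanisms -/

theorem isImplementable_fix (I : Finset (Fin (k + 1))) :
    S.IsImplementable k (fun b i => i ∉ I ∧ S.FixSelected k I b i)
      (fun b i => i ∈ I ∧ S.FixSelected k I b i) where
  measurableSet_ad i := (MeasurableSet.const _).inter (S.measurableSet_fixSelected k I i)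
  measurableSet_org i := (MeasurableSet.const _).inter (S.measurableSet_fixSelected k I i)
  not_org_of_ad _ _ h h' := h.1 h'.1
  displayed_le b := by
    classical
    obtain ⟨j, hj, -⟩ := S.exists_forall_fixSelected_iff_ne I b
    refine ⟨Finset.univ.erase j, by simp, fun i hi => ?_⟩
    exact Finset.mem_erase.2 ⟨(hj i).1 (hi.elim And.right And.right), Finset.mem_univ i⟩
  ad_mono b _ _ hs _ ht hst h := ⟨h.1, S.fixSelected_update_mono b h.1 hs ht hst h.2⟩
  org_update b i t := and_congr_right fun hi => by
    unfold FixSelected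
    rw [S.fixValue_update_of_mem b hi]

theorem isImplementable_fixNonneg (I : Finset (Fin (k + 1))) :
    S.IsImplementable k (fun b i => i ∉ I ∧ S.FixSelected k I b i ∧ 0 ≤ S.adValue i (b i))
      (fun b i => i ∈ I ∧ S.FixSelected k I b i) where
  measurableSet_ad i := (MeasurableSet.const _).inter ((S.measurableSet_fixSelected k I i).inter
    (measurableSet_le measurable_const ((S.measurable_adValue i).comp (measurable_pi_apply i))))
  measurableSet_org := (S.isImplementable_fix I).measurableSet_org
  not_org_of_ad _ _ h h' := h.1 h'.1
  displayed_le b := by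
    obtain ⟨s, hs, hmem⟩ := (S.isImplementable_fix I).displayed_le b
    exact ⟨s, hs, fun i hi => hmem i (hi.imp_left fun h => ⟨h.1, h.2.1⟩)⟩
  ad_mono b i s hs t ht hst h := by
    refine ⟨h.1, S.fixSelected_update_mono b h.1 hs ht hst h.2.1, ?_⟩
    have h1 := h.2.2
    rw [Function.update_self] at h1 ⊢
    exact h1.trans (S.adValue_monotoneOn i hs ht hst)
  org_update := (S.isImplementable_fix I).org_update

open Classical in
/-- The expected positive part of the contribution of item `i` when the items in `I` are organic
and the others are ads. -/
noncomputable def formValue (I : Finset (Fin (k + 1))) (i : Fin (k + 1)) : ℝ :=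
  if i ∈ I then S.orgValue i else S.adOptimum i

theorem integral_max_fixValue (I : Finset (Fin (k + 1))) (i : Fin (k + 1)) :
    Integrable (fun b => max (S.fixValue I b i) 0) S.profileLaw ∧
      ∫ b, max (S.fixValue I b i) 0 ∂S.profileLaw = S.formValue I i := by
  by_cases hi : i ∈ I
  · have h0 : 0 ≤ S.orgValue i := S.γO_nonneg i
    simp [fixValue, formValue, hi, h0]
  · have hmp := measurePreserving_eval S.bidLaw i
    have hint := (S.integrable_adValue i).pos_part
    simp only [fixValue, formValue, hi, if_false]
    refine ⟨hmp.integrable_comp_of_integrable hint, ?_⟩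
    have h := integral_map hmp.measurable.aemeasurable (f := fun t => max (S.adValue i t) 0)
      (by rw [hmp.map_eq]; exact hint.aestronglyMeasurable)
    rw [hmp.map_eq] at h
    exact h.symm

/-- A mechanism that displays the selected items, up to ads of negative contribution, is profile by
profile at least as good as displaying all items but one fixed item `l`. -/
theorem sum_erase_formValue_le_objective {ad org : (Fin (k + 1) → ℝ) → Fin (k + 1) → Prop}
    (h : S.IsImplementable k ad org) (I : Finset (Fin (k + 1)))
    (hsel : ∀ b ∈ S.profiles, ∀ i, S.FixSelected k I b i →
      S.displayedValue ad org b i = max (S.fixValue I b i) 0)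
    (hnot : ∀ b i, ¬ S.FixSelected k I b i → S.displayedValue ad org b i = 0)
    (l : Fin (k + 1)) :
    ∑ i ∈ Finset.univ.erase l, S.formValue I i ≤ S.objective (criticalMechanism S ad org) := by
  have hint : ∀ i, Integrable (fun b => max (S.fixValue I b i) 0) S.profileLaw := fun i =>
    (S.integral_max_fixValue I i).1
  simp_rw [← fun i => (S.integral_max_fixValue I i).2]
  rw [h.objective_eq, ← integral_finsetSum _ fun i _ => hint i,
    ← integral_finsetSum _ fun i _ => h.integrable_displayedValue i]
  refine integral_mono_ae (integrable_finsetSum _ fun i _ => hint i)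
    (integrable_finsetSum _ fun i _ => h.integrable_displayedValue i) ?_
  filter_upwards [S.ae_mem_profiles] with b hb
  obtain ⟨j, hj, hmin⟩ := S.exists_forall_fixSelected_iff_ne I b
  have hdisp : ∑ i, S.displayedValue ad org b i =
      ∑ i ∈ Finset.univ.erase j, max (S.fixValue I b i) 0 := by
    rw [← Finset.sum_erase_add Finset.univ _ (Finset.mem_univ j),
      hnot b j fun h' => (hj j).1 h' rfl, add_zero]
    exact Finset.sum_congr rfl fun i hi => hsel b hb i ((hj i).2 (Finset.ne_of_mem_erase hi))
  rw [hdisp]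
  have h1 := Finset.sum_erase_add Finset.univ (fun i => max (S.fixValue I b i) 0)
    (Finset.mem_univ j)
  have h2 := Finset.sum_erase_add Finset.univ (fun i => max (S.fixValue I b i) 0)
    (Finset.mem_univ l)
  have h3 := max_le_max_right 0 (hmin l)
  linarith

theorem sum_erase_formValue_le_objective_fixMechanism
    (hS : ∀ i, ∀ t ∈ Icc 0 (S.B i), 0 ≤ S.adValue i t) (I : Finset (Fin (k + 1)))
    (l : Fin (k + 1)) :
    ∑ i ∈ Finset.univ.erase l, S.formValue I i ≤ S.objective (S.fixMechanism k I) := by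
  refine S.sum_erase_formValue_le_objective (S.isImplementable_fix I) I (fun b hb i hi => ?_)
    (fun b i hi => by simp [displayedValue, hi]) l
  have ho : 0 ≤ S.orgValue i := S.γO_nonneg i
  have ha := hS i (b i) (hb i)
  by_cases hI : i ∈ I <;> simp [displayedValue, fixValue, hi, hI, ho, ha]

theorem sum_erase_formValue_le_objective_fixMechanismNonneg (I : Finset (Fin (k + 1)))
    (l : Fin (k + 1)) :
    ∑ i ∈ Finset.univ.erase l, S.formValue I i ≤ S.objective (S.fixMechanismNonneg k I) := by
  refine S.sum_erase_formValue_le_objective (S.isImplementable_fixNonneg I) I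
    (fun b _ i hi => ?_) (fun b i hi => by simp [displayedValue, hi]) l
  have ho : 0 ≤ S.orgValue i := S.γO_nonneg i
  by_cases hI : i ∈ I
  · simp [displayedValue, fixValue, hi, hI, ho]
  · by_cases ha : 0 ≤ S.adValue i (b i)
    · simp [displayedValue, fixValue, hi, hI, ha]
    · simp [displayedValue, fixValue, hI, ha, (not_le.1 ha).le]

/-- The approximation bound: leave out the item whose better form is worth least and let the other
`k` items take part in their better forms. -/
theorem isApproximate_of_isBestOf {m : Finset (Fin (k + 1)) → Mechanism (k + 1)}
    (hadm : ∀ I, S.Admissible k (m I))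
    (hm : ∀ I l, ∑ i ∈ Finset.univ.erase l, S.formValue I i ≤ S.objective (m I))
    {M : Mechanism (k + 1)} (hM : S.IsBestOf k m M) {τ : ℝ} (hτ0 : 0 ≤ τ)
    (hτ : τ ≤ (k / (k + 1) : ℝ)) : S.IsApproximate k τ M := by
  classical
  obtain ⟨J, -, rfl, hbest⟩ := hM
  refine ⟨hadm J, fun M' hM' => ?_⟩
  obtain ⟨l, -, hl⟩ := Finset.exists_min_image Finset.univ
    (fun i => max (S.orgValue i) (S.adOptimum i)) ⟨0, Finset.mem_univ _⟩
  set I := (Finset.univ.erase l).filter fun i => S.adOptimum i ≤ S.orgValue i with hI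
  have hIcard : I.card ≤ k := (Finset.card_filter_le _ _).trans (by simp)
  have hpos : 0 ≤ ∑ i, max (S.orgValue i) (S.adOptimum i) :=
    Finset.sum_nonneg fun i _ => (S.γO_nonneg i).trans (le_max_left _ _)
  calc τ * S.objective M' ≤ τ * ∑ i, max (S.orgValue i) (S.adOptimum i) :=
        mul_le_mul_of_nonneg_left hM'.objective_le hτ0
    _ ≤ (k / (k + 1) : ℝ) * ∑ i, max (S.orgValue i) (S.adOptimum i) :=
        mul_le_mul_of_nonneg_right hτ hpos
    _ ≤ ∑ i ∈ Finset.univ.erase l, max (S.orgValue i) (S.adOptimum i) :=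
        div_mul_sum_le_sum_erase _ fun i => hl i (Finset.mem_univ i)
    _ = ∑ i ∈ Finset.univ.erase l, S.formValue I i := by
        refine Finset.sum_congr rfl fun i hi => ?_
        have hmem : i ∈ I ↔ S.adOptimum i ≤ S.orgValue i := by
          rw [hI, Finset.mem_filter, and_iff_right hi]
        by_cases h : S.adOptimum i ≤ S.orgValue i
        · simp [formValue, hmem, h]
        · simp [formValue, hmem, h, (not_le.1 h).le]
    _ ≤ S.objective (m I) := hm I l
    _ ≤ S.objective (m J) := hbest I hIcard

end MergingInstance

theorem mainTheorem3 (S : MergingInstance 3) :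
    ((∀ i, ∀ t ∈ Set.Icc 0 (S.B i), 0 ≤ S.adValue i t) →
      ∀ M : Mechanism 3, S.IsGFix 2 M → S.IsApproximate 2 ((4 / 5 : ℝ) ^ 3) M) ∧
    ∀ M : Mechanism 3, S.IsGFixNonneg 2 M → S.IsApproximate 2 ((4 / 5 : ℝ) ^ 3) M := by
  -- The bound obtained is `2 / 3`, which exceeds `(4 / 5) ^ 3 = 0.512`.
  have hτ : (4 / 5 : ℝ) ^ 3 ≤ ((2 : ℕ) : ℝ) / (((2 : ℕ) : ℝ) + 1) := by norm_num
  refine ⟨fun hS M hM => ?_, fun M hM => ?_⟩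
  · exact S.isApproximate_of_isBestOf (fun I => (S.isImplementable_fix I).admissible)
      (S.sum_erase_formValue_le_objective_fixMechanism hS) hM (by positivity) hτ
  · exact S.isApproximate_of_isBestOf (fun I => (S.isImplementable_fixNonneg I).admissible)
      S.sum_erase_formValue_le_objective_fixMechanismNonneg hM (by positivity) hτ
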